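/- Setting. Let $d\in\{2,3\}$, let $\Omega\subset\mathbb R^d$ be a bounded open set, and let the wave speed $c$ be measurable with $0<c_{\min}\le c\le c_{\max}$ on $\Omega$. Let $\mathcal A=-c\,\Delta[c\,\cdot\,]$ be the self-adjoint operator on $L^2(\Omega)$ with homogeneous Dirichlet conditions, that is, $u$ is in the domain of $\mathcal A$ if and only if $cu\in H^1_0(\Omega)$ and $\Delta(cu)\in L^2(\Omega)$. It has positive eigenvalues $\theta_l$ and an orthonormal basis of eigenfunctions $y_l$, and functions of $\mathcal A$ are $\Phi(\mathcal A)v=\sum_l\Phi(\theta_l)\langle y_l,v\rangle y_l$. Let $x_1,\dots,x_m\in\Omega$ be the positions of co-located sources and receivers, and let $c$ be equal to one constant $\bar c$ near each of them. Let the real signal $f$ be continuously differentiable, with $f$ and $f'$ integrable, and put $\hat f(\omega)=\int_{\mathbb R}f(t)e^{i\omega t}\,dt$. Put $$u_0^{(s)}=\big|\hat f(\sqrt{\mathcal A})\big|\,\delta_{x_s}=\sum_l|\hat f(\sqrt{\theta_l})|\,y_l(x_s)\,y_l,\qquad u^{(s)}(t)=\cos(t\sqrt{\mathcal A})\,u_0^{(s)},$$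 and assume that this series converges in $L^2(\Omega)$ and that $u_0^{(s)}$ is in the domain of $\mathcal A$, for $s=1,\dots,m$. Data. Let $\mathcal M_{r,s}(t)=P^{(s)}(t,x_r)$, where $P^{(s)}$ is the causal solution of $(\partial_t^2+\mathcal A)P^{(s)}=f(t)\delta_{x_s}$. The $m\times m$ data matrix is $D(t)=\mathcal M^f(t)+\mathcal M^f(-t)$, where $\mathcal M^f(t)=-f'(-t)\star_t\mathcal M(t)$. It is understood through the eigenfunction expansion: $$D_{r,s}(t)=\sum_l y_l(x_r)\,y_l(x_s)\,[q_l^f(t)+q_l^f(-t)],\qquad q_l^f(t)=-f'(-t)\star_t q_l(t),\qquad q_l(t)=\int_{-\infty}^t f(t')\,\frac{\sin(\sqrt{\theta_l}\,(t-t'))}{\sqrt{\theta_l}}\,dt'.$$ Galerkin approximation. Let $\tau>0$ and $n\ge1$. Let $u_j=(u^{(1)}(j\tau),\dots,u^{(m)}(j\tau))$ and $U=(u_0,\dots,u_{n-1})$, and assume that the $nm$ components of $U$ are linearly independent. The Galerkin approximation of the wave equation $(\partial_t^2+\mathcal A)u=0$ with initial conditions $u(0)=u_0$, $\partial_tu(0)=0$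 is $\tilde u^{\rm Gal}(t)=U\tilde g(t)$, $t\ge0$, where the twice differentiable $nm\times m$ coefficient matrix $\tilde g(t)$ is such that, for all $t\ge0$, the residual $U\tilde g''(t)+\mathcal AU\tilde g(t)$ is orthogonal in $L^2(\Omega)$ to the span of the components of $U$, and such that $\tilde u^{\rm Gal}$ satisfies the same initial conditions. Its stiffness matrix is $\tilde S=\int_\Omega U^T\mathcal AU\,dx$. Theorem. The components of $U$ are in the domain of $\mathcal A$, and: (i) The Galerkin coefficients satisfy the initial conditions $\tilde g(0)=e_0$ and $\tilde g'(0)=0$, where $e_0$ consists of the first $m$ columns of the $nm\times nm$ identity matrix. (ii) The data matrix $D$ is twice continuously differentiable, and the $m\times m$ blocks of the stiffness matrix are $$\tilde S_{i,j}=\int_\Omega u_i^T\,\mathcal A\,u_j\,dx=-\tfrac12\big[\ddot D_{i+j}+\ddot D_{|i-j|}\big],\qquad i,j=0,\dots,n-1,$$ where $\ddot D_j$ is the second derivative of $D(t)$ at $t=j\tau$. -/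

import Mathlib

open MeasureTheory Set Filter Topology
open scoped ContDiff Convolution

noncomputable section

namespace WaveROM

/-- Euclidean space `ℝ^d`. -/
abbrev Space (d : ℕ) : Type := EuclideanSpace ℝ (Fin d)

/-- The real Hilbert space `L²(Ω)`. -/
abbrev L2 {d : ℕ} (Ω : Set (Space d)) : Type := Lp ℝ 2 (volume.restrict Ω)

/-- The Hilbert space `L²(Ω; ℝ^d)` of square integrable vector fields. -/
abbrev L2Vec {d : ℕ} (Ω : Set (Space d)) : Type := Lp (Space d) 2 (volume.restrict Ω)

/-- Smooth test functions with compact support in `Ω`. -/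
def IsTest {d : ℕ} (Ω : Set (Space d)) (φ : Space d → ℝ) : Prop :=
  ContDiff ℝ ∞ φ ∧ HasCompactSupport φ ∧ tsupport φ ⊆ Ω

/-- The Sobolev space `H¹₀(Ω)`, as the set of the pairs `(w, ∇w)`: the closure in
`L²(Ω) × L²(Ω; ℝ^d)` of the pairs `(φ, ∇φ)` with `φ` a test function. -/
def sobolevZero {d : ℕ} (Ω : Set (Space d)) : Submodule ℝ (L2 Ω × L2Vec Ω) :=
  (Submodule.span ℝ {p : L2 Ω × L2Vec Ω | ∃ φ : Space d → ℝ, IsTest Ω φ ∧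
    p.1 =ᵐ[volume.restrict Ω] φ ∧ p.2 =ᵐ[volume.restrict Ω] gradient φ}).topologicalClosure

/-- `(u, v)` is in the graph of `-c Δ[c ·]` with homogeneous Dirichlet conditions: `w = c u` lies in
`H¹₀(Ω)` and `-Δ w = v / c` in the sense of distributions on `Ω`. -/
def InWaveGraph {d : ℕ} (Ω : Set (Space d)) (c : Space d → ℝ) (u v : L2 Ω) : Prop :=
  ∃ (w : L2 Ω) (G : L2Vec Ω), (w, G) ∈ sobolevZero Ω ∧
    (∀ᵐ x ∂(volume.restrict Ω), w x = c x * u x) ∧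
    ∀ φ : Space d → ℝ, IsTest Ω φ →
      Integrable (fun x => v x / c x * φ x) (volume.restrict Ω) ∧
      ∫ x in Ω, inner ℝ (G x) (gradient φ x) = ∫ x in Ω, v x / c x * φ x

/-- The inner product of a square integrable field with the gradient of a test function is
integrable. -/
theorem integrable_inner_gradient {d : ℕ} {Ω : Set (Space d)} (G : L2Vec Ω) {φ : Space d → ℝ}
    (hφ : IsTest Ω φ) :
    Integrable (fun x => inner ℝ (G x) (gradient φ x)) (volume.restrict Ω) := by
  have hcont : Continuous (gradient φ) := by
    have h1 : Continuous (fderiv ℝ φ) := hφ.1.continuous_fderiv (by simp)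
    exact (InnerProductSpace.toDual ℝ (Space d)).symm.continuous.comp h1
  have hsupp : HasCompactSupport (gradient φ) := by
    have h1 : HasCompactSupport (fderiv ℝ φ) := hφ.2.1.fderiv ℝ
    exact h1.comp_left (g := (InnerProductSpace.toDual ℝ (Space d)).symm) (by simp)
  have hmem : MemLp (gradient φ) 2 (volume.restrict Ω) :=
    (hcont.memLp_of_hasCompactSupport hsupp).restrict Ω
  refine (L2.integrable_inner (𝕜 := ℝ) G (hmem.toLp _)).congr ?_
  filter_upwards [hmem.coeFn_toLp] with x hx
  rw [hx]

/-- The graph of the wave operator, as a linear subspace of `L²(Ω) × L²(Ω)`. -/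
def waveGraph {d : ℕ} (Ω : Set (Space d)) (c : Space d → ℝ) : Submodule ℝ (L2 Ω × L2 Ω) where
  carrier := {p | InWaveGraph Ω c p.1 p.2}
  zero_mem' := by
    refine ⟨0, 0, (sobolevZero Ω).zero_mem, ?_, fun φ _ => ?_⟩
    · filter_upwards [Lp.coeFn_zero ℝ 2 (volume.restrict Ω)] with x hx
      change (0 : L2 Ω) x = c x * (0 : L2 Ω) x
      rw [hx]
      simp
    · have h1 : (fun x => ((0 : L2 Ω) x) / c x * φ x) =ᵐ[volume.restrict Ω] fun _ => 0 := by
        filter_upwards [Lp.coeFn_zero ℝ 2 (volume.restrict Ω)] with x hx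
        rw [hx]
        simp
      have h2 : (fun x => inner ℝ ((0 : L2Vec Ω) x) (gradient φ x))
          =ᵐ[volume.restrict Ω] fun _ => 0 := by
        filter_upwards [Lp.coeFn_zero (Space d) 2 (volume.restrict Ω)] with x hx
        rw [hx]
        simp only [Pi.zero_apply, inner_zero_left]
      exact ⟨(integrable_zero _ _ _).congr h1.symm,
        (integral_congr_ae h2).trans (integral_congr_ae h1).symm⟩
  add_mem' := by
    rintro ⟨u, v⟩ ⟨u', v'⟩ ⟨w, G, hw, hcw, hG⟩ ⟨w', G', hw', hcw', hG'⟩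
    refine ⟨w + w', G + G', (sobolevZero Ω).add_mem hw hw', ?_, fun φ hφ => ?_⟩
    · filter_upwards [hcw, hcw', Lp.coeFn_add w w', Lp.coeFn_add u u'] with x h1 h2 h3 h4
      rw [h3, Pi.add_apply, h1, h2]
      simp only [Prod.mk_add_mk]
      rw [h4, Pi.add_apply]
      ring
    · have h1 : (fun x => ((v + v' : L2 Ω) x) / c x * φ x) =ᵐ[volume.restrict Ω]
          fun x => v x / c x * φ x + v' x / c x * φ x := by
        filter_upwards [Lp.coeFn_add v v'] with x hx
        rw [hx, Pi.add_apply]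
        ring
      have h2 : (fun x => inner ℝ ((G + G' : L2Vec Ω) x) (gradient φ x))
          =ᵐ[volume.restrict Ω]
          fun x => inner ℝ (G x) (gradient φ x) + inner ℝ (G' x) (gradient φ x) := by
        filter_upwards [Lp.coeFn_add G G'] with x hx
        rw [hx, Pi.add_apply, inner_add_left]
      refine ⟨((hG φ hφ).1.add (hG' φ hφ).1).congr h1.symm, ?_⟩
      refine (integral_congr_ae h2).trans (Eq.trans ?_ (integral_congr_ae h1).symm)
      rw [integral_add (integrable_inner_gradient G hφ) (integrable_inner_gradient G' hφ),
        integral_add (hG φ hφ).1 (hG' φ hφ).1, (hG φ hφ).2, (hG' φ hφ).2]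
  smul_mem' := by
    rintro a ⟨u, v⟩ ⟨w, G, hw, hcw, hG⟩
    refine ⟨a • w, a • G, (sobolevZero Ω).smul_mem a hw, ?_, fun φ hφ => ?_⟩
    · filter_upwards [hcw, Lp.coeFn_smul a w, Lp.coeFn_smul a u] with x h1 h2 h3
      rw [h2, Pi.smul_apply, h1]
      simp only [Prod.smul_mk]
      rw [h3, Pi.smul_apply, smul_eq_mul, smul_eq_mul]
      ring
    · have h1 : (fun x => ((a • v : L2 Ω) x) / c x * φ x) =ᵐ[volume.restrict Ω]
          fun x => a * (v x / c x * φ x) := by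
        filter_upwards [Lp.coeFn_smul a v] with x hx
        rw [hx, Pi.smul_apply, smul_eq_mul]
        ring
      have h2 : (fun x => inner ℝ ((a • G : L2Vec Ω) x) (gradient φ x))
          =ᵐ[volume.restrict Ω] fun x => a * inner ℝ (G x) (gradient φ x) := by
        filter_upwards [Lp.coeFn_smul a G] with x hx
        rw [hx, Pi.smul_apply, real_inner_smul_left]
      refine ⟨((hG φ hφ).1.const_mul a).congr h1.symm, ?_⟩
      refine (integral_congr_ae h2).trans (Eq.trans ?_ (integral_congr_ae h1).symm)
      rw [integral_const_mul, integral_const_mul, (hG φ hφ).2]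

/-- The symmetrized wave operator `𝒜 = -c Δ[c ·]` on `L²(Ω)` with homogeneous Dirichlet conditions,
an unbounded operator with domain `{u | c u ∈ H¹₀(Ω), Δ(c u) ∈ L²(Ω)}` when `c` is bounded above and
below by positive constants. -/
def waveOp {d : ℕ} (Ω : Set (Space d)) (c : Space d → ℝ) : L2 Ω →ₗ.[ℝ] L2 Ω :=
  (waveGraph Ω c).toLinearPMap

/-- The eigenspace `{v | 𝒜 v = θ v}`; it is trivial unless `θ` is an eigenvalue. -/
def eigenSpace {d : ℕ} (Ω : Set (Space d)) (c : Space d → ℝ) (θ : ℝ) : Submodule ℝ (L2 Ω) :=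
  (waveGraph Ω c).comap (LinearMap.prod LinearMap.id (θ • LinearMap.id))

/-- Functional calculus: `Φ(𝒜) v` is the sum of `Φ(θ)` times the orthogonal projection of `v` on the
eigenspace of `θ` (an eigenspace is closed, so that its closure is the eigenspace itself). -/
def funCalc {d : ℕ} (Ω : Set (Space d)) (c : Space d → ℝ) (Φ : ℝ → ℝ) (v : L2 Ω) : L2 Ω :=
  ∑' θ : ℝ, Φ θ • (eigenSpace Ω c θ).topologicalClosure.starProjection v

/-- The class `v ∈ L²(Ω)` has the value `a` at the point `x`: it has a representative that is
continuous at `x`, with value `a` there. -/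
def HasPointValue {d : ℕ} {Ω : Set (Space d)} (v : L2 Ω) (x : Space d) (a : ℝ) : Prop :=
  ∃ g : Space d → ℝ, ContinuousAt g x ∧ g x = a ∧ v =ᵐ[volume.restrict Ω] g

/-- `k` is the component of the Dirac delta `δ_x` in the eigenspace of `θ`: the element of that
eigenspace with `⟪k, v⟫ = v(x)` for every `v` in it, that is, `k = ∑ⱼ yⱼ(x) yⱼ` for any orthonormal
basis `(yⱼ)` of the eigenspace. -/
def IsDeltaComponent {d : ℕ} (Ω : Set (Space d)) (c : Space d → ℝ) (x : Space d) (θ : ℝ)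
    (k : L2 Ω) : Prop :=
  k ∈ eigenSpace Ω c θ ∧ ∀ v ∈ eigenSpace Ω c θ, HasPointValue v x (inner ℝ k v)

open Classical in
/-- The component of `δ_x` in the eigenspace of `θ`. -/
def deltaComponent {d : ℕ} (Ω : Set (Space d)) (c : Space d → ℝ) (x : Space d) (θ : ℝ) : L2 Ω :=
  if h : ∃ k : L2 Ω, IsDeltaComponent Ω c x θ k then h.choose else 0

/-- The Fourier transform `f̂(ξ) = ∫ f(t) e^{iξt} dt`. -/
def fourierHat (f : ℝ → ℝ) (ξ : ℝ) : ℂ :=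
  ∫ t : ℝ, (f t : ℂ) * Complex.exp (Complex.I * ξ * t)

/-- The terms of the eigenfunction expansion of `|f̂(√𝒜)| δ_x`. -/
def initialTerm {d : ℕ} (Ω : Set (Space d)) (c : Space d → ℝ) (f : ℝ → ℝ) (x : Space d)
    (θ : ℝ) : L2 Ω :=
  ‖fourierHat f (√θ)‖ • deltaComponent Ω c x θ

/-- The initial state `u₀ = |f̂(√𝒜)| δ_x`. -/
def initialState {d : ℕ} (Ω : Set (Space d)) (c : Space d → ℝ) (f : ℝ → ℝ) (x : Space d) : L2 Ω :=
  ∑' θ : ℝ, initialTerm Ω c f x θ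

/-- The wave `u(t) = cos(t√𝒜) u₀`. -/
def wave {d : ℕ} (Ω : Set (Space d)) (c : Space d → ℝ) (f : ℝ → ℝ) (x : Space d) (t : ℝ) : L2 Ω :=
  funCalc Ω c (fun θ => Real.cos (t * √θ)) (initialState Ω c f x)

/-- The causal Green's function `H(t) sin(t√θ)/√θ` of `∂ₜ² + θ`. -/
def greenMode (θ : ℝ) (t : ℝ) : ℝ :=
  if 0 ≤ t then Real.sin (t * √θ) / √θ else 0

/-- The causal solution `f ⋆ H(t) sin(t√θ)/√θ` of `q'' + θ q = f`. With point source at `x`, the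
solution of `(∂ₜ² + 𝒜) P = f(t) δ_x` has the component `q(t) • deltaComponent Ω c x θ` in the
eigenspace of `θ`. -/
def pressureMode (f : ℝ → ℝ) (θ : ℝ) : ℝ → ℝ :=
  f ⋆[ContinuousLinearMap.mul ℝ ℝ, volume] greenMode θ

/-- The convolution in time of `-f'(-t)` with `pressureMode f θ`. -/
def filteredMode (f : ℝ → ℝ) (θ : ℝ) : ℝ → ℝ :=
  (fun t => -deriv f (-t)) ⋆[ContinuousLinearMap.mul ℝ ℝ, volume] pressureMode f θ

/-- The data matrix `D(t) = 𝓜ᶠ(t) + 𝓜ᶠ(-t)` with `𝓜ᶠ = -f'(-t) ⋆ 𝓜`, where `𝓜_{r,s}(t)` is the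
value at the point `x_r` of the causal wave generated by the source `f(t) δ_{x_s}`. The values at the
points are taken mode by mode: `⟪deltaComponent x_r θ, deltaComponent x_s θ⟫ = ∑ⱼ yⱼ(x_r) yⱼ(x_s)`,
with `(yⱼ)` an orthonormal basis of the eigenspace of `θ`. -/
def dataMatrix {d m : ℕ} (Ω : Set (Space d)) (c : Space d → ℝ) (f : ℝ → ℝ)
    (x : Fin m → Space d) (t : ℝ) : Matrix (Fin m) (Fin m) ℝ :=
  Matrix.of fun r s => ∑' θ : ℝ, (filteredMode f θ t + filteredMode f θ (-t)) *
    inner ℝ (deltaComponent Ω c (x r) θ) (deltaComponent Ω c (x s) θ)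

/-- The second time derivative of the data matrix at the instant `j τ`. -/
def dataAccel {d m : ℕ} (Ω : Set (Space d)) (c : Space d → ℝ) (f : ℝ → ℝ)
    (x : Fin m → Space d) (τ : ℝ) (j : ℕ) : Matrix (Fin m) (Fin m) ℝ :=
  Matrix.of fun r s => iteratedDeriv 2 (fun t => dataMatrix Ω c f x t r s) (j * τ)

/-- The snapshots `u_j^{(s)} = u^{(s)}(jτ)`, `0 ≤ j < n`: the components of the row vector field
`U = (u_0, …, u_{n-1})`. -/
def snapshot {d n m : ℕ} (Ω : Set (Space d)) (c : Space d → ℝ) (f : ℝ → ℝ)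
    (x : Fin m → Space d) (τ : ℝ) (k : Fin n × Fin m) : L2 Ω :=
  wave Ω c f (x k.2) ((k.1 : ℕ) * τ)

/-- The column `s` of the field `U g`, for a coefficient matrix `g`. -/
def galerkinField {d n m : ℕ} {Ω : Set (Space d)} (U : Fin n × Fin m → L2 Ω)
    (g : Matrix (Fin n × Fin m) (Fin m) ℝ) (s : Fin m) : L2 Ω :=
  ∑ k, g k s • U k

/-- `g` is the coefficient function of the Galerkin approximation `U g(t)`, `t ≥ 0`, of the wave
equation `(∂ₜ² + 𝒜) u = 0` with initial state `u₀` and zero initial velocity, in the span of the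
components of `U`; `g'` and `g''` are its time derivatives. -/
structure IsGalerkin {d n m : ℕ} {Ω : Set (Space d)} (A : L2 Ω →ₗ.[ℝ] L2 Ω)
    (U : Fin n × Fin m → L2 Ω) (hU : ∀ k, U k ∈ A.domain) (u₀ : Fin m → L2 Ω)
    (g g' g'' : ℝ → Matrix (Fin n × Fin m) (Fin m) ℝ) : Prop where
  hasDeriv : ∀ t, 0 ≤ t → ∀ k s, HasDerivWithinAt (fun r => g r k s) (g' t k s) (Ici 0) t
  hasDeriv' : ∀ t, 0 ≤ t → ∀ k s, HasDerivWithinAt (fun r => g' r k s) (g'' t k s) (Ici 0) t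
  residual_orthogonal : ∀ t, 0 ≤ t → ∀ s,
    galerkinField U (g'' t) s + ∑ k, g t k s • A ⟨U k, hU k⟩ ∈ (Submodule.span ℝ (range U))ᗮ
  initial_state : ∀ s, galerkinField U (g 0) s = u₀ s
  initial_velocity : ∀ s,
    HasDerivWithinAt (fun t => galerkinField U (g t) s) 0 (Ici 0) 0

/-- The column block `e_j` of the identity matrix of size `nm`. -/
def unitBlock {n m : ℕ} (j : Fin n) : Matrix (Fin n × Fin m) (Fin m) ℝ :=
  (1 : Matrix (Fin n × Fin m) (Fin n × Fin m) ℝ).submatrix id fun s => (j, s)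

/-- The stiffness matrix `∫ Uᵀ 𝒜 U`. -/
def stiffness {d n m : ℕ} {Ω : Set (Space d)} (A : L2 Ω →ₗ.[ℝ] L2 Ω)
    (U : Fin n × Fin m → L2 Ω) (hU : ∀ k, U k ∈ A.domain) :
    Matrix (Fin n × Fin m) (Fin n × Fin m) ℝ :=
  Matrix.of fun k l => ∫ x in Ω, U k x * A ⟨U l, hU l⟩ x

/-- The block `(i, j)`, of size `m`, of a matrix of size `nm`. -/
def block {n m : ℕ} (S : Matrix (Fin n × Fin m) (Fin n × Fin m) ℝ) (i j : Fin n) :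
    Matrix (Fin m) (Fin m) ℝ :=
  S.submatrix (fun r => (i, r)) fun s => (j, s)

end WaveROM

end

namespace WaveROM

/-! Everything is diagonal in the eigenspaces of the wave operator `𝒜`. Write `a_θ` for the term
`initialTerm` at `θ`, the part of `u₀` in the eigenspace of `θ`. Then `u(t) = ∑ cos(t√θ) a_θ`, and
since different eigenspaces are orthogonal, `⟪u_i, 𝒜 u_j⟫ = ∑ θ cos(iτ√θ) cos(jτ√θ) ⟪a_θ, a_θ'⟫`,
where `a_θ` and `a_θ'` belong to the two sources. On the data side, the symmetrized filtered mode
equals `|f̂(√θ)|² cos(t√θ)` (`filteredMode_add_neg`), so that `D(t) = ∑ cos(t√θ) ⟪a_θ, a_θ'⟫` and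
`D''` brings down `-θ`. The product-to-sum formula for cosines then gives (ii).

No spectral theorem is needed, because the series of `u₀` converges by assumption. It is enough that
the graph of `𝒜` is closed, symmetric, nonnegative and single-valued (`waveGraph_properties`).
Symmetry and `u₀ ∈ dom 𝒜` give `∑ ‖θ a_θ‖² ≤ ‖𝒜 u₀‖²` (`summable_smul_initialTerm`); this makes the
differentiated data series converge absolutely, and closedness of the graph lets `𝒜` act termwise on
the wave (`wave_expansion`).

Part (i) is the linear independence of the snapshots, as `u₀` is itself the first block of them. -/

/-- Multiplication by an essentially bounded function is a continuous linear map on `L²`. -/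
theorem exists_mulCLM {α : Type*} [MeasurableSpace α] {μ : Measure α} {a : α → ℝ} {K : ℝ}
    (ha : AEStronglyMeasurable a μ) (hK : ∀ᵐ x ∂μ, |a x| ≤ K) :
    ∃ M : Lp ℝ 2 μ →L[ℝ] Lp ℝ 2 μ, ∀ u, M u =ᵐ[μ] fun x => a x * u x := by
  have hmem (u : Lp ℝ 2 μ) : MemLp (fun x => a x * u x) 2 μ := by
    refine (Lp.memLp u).of_le_mul (c := K) (ha.mul (Lp.aestronglyMeasurable u)) ?_
    filter_upwards [hK] with x hx
    rw [norm_mul]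
    exact mul_le_mul_of_nonneg_right hx (norm_nonneg _)
  let L : Lp ℝ 2 μ →ₗ[ℝ] Lp ℝ 2 μ :=
    { toFun := fun u => (hmem u).toLp _
      map_add' := fun u v => by
        apply Lp.ext
        filter_upwards [(hmem (u + v)).coeFn_toLp, (hmem u).coeFn_toLp, (hmem v).coeFn_toLp,
          Lp.coeFn_add u v, Lp.coeFn_add ((hmem u).toLp _) ((hmem v).toLp _)]
          with x h1 h2 h3 h4 h5
        rw [h1, h5, Pi.add_apply, h2, h3, h4, Pi.add_apply, mul_add]
      map_smul' := fun b u => by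
        apply Lp.ext
        filter_upwards [(hmem (b • u)).coeFn_toLp, (hmem u).coeFn_toLp,
          Lp.coeFn_smul b u, Lp.coeFn_smul b ((hmem u).toLp _)] with x h1 h2 h4 h5
        rw [RingHom.id_apply, h1, h5, Pi.smul_apply, h2, h4, Pi.smul_apply, smul_eq_mul,
          smul_eq_mul, mul_left_comm] }
  refine ⟨L.mkContinuous K fun u => ?_, fun u => (hmem u).coeFn_toLp⟩
  refine Lp.norm_le_mul_norm_of_ae_le_mul ?_
  filter_upwards [hK, (hmem u).coeFn_toLp] with x hx h1
  change ‖(hmem u).toLp _ x‖ ≤ _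
  rw [h1, norm_mul]
  exact mul_le_mul_of_nonneg_right hx (norm_nonneg _)

/-! ### The wave operator through its weak formulation. -/

section WaveOperator

variable {d : ℕ} {Ω : Set (Space d)} {c : Space d → ℝ}

theorem IsTest.memLp {φ : Space d → ℝ} (hφ : IsTest Ω φ) : MemLp φ 2 (volume.restrict Ω) :=
  (hφ.1.continuous.memLp_of_hasCompactSupport hφ.2.1).restrict Ω

theorem IsTest.memLp_gradient {φ : Space d → ℝ} (hφ : IsTest Ω φ) :
    MemLp (gradient φ) 2 (volume.restrict Ω) := by
  have hcont : Continuous (gradient φ) :=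
    (InnerProductSpace.toDual ℝ (Space d)).symm.continuous.comp
      (hφ.1.continuous_fderiv (by simp))
  have hsupp : HasCompactSupport (gradient φ) :=
    (hφ.2.1.fderiv ℝ).comp_left (g := (InnerProductSpace.toDual ℝ (Space d)).symm) (by simp)
  exact (hcont.memLp_of_hasCompactSupport hsupp).restrict Ω

theorem IsTest.mem_sobolevZero {φ : Space d → ℝ} (hφ : IsTest Ω φ) :
    (hφ.memLp.toLp φ, hφ.memLp_gradient.toLp (gradient φ)) ∈ sobolevZero Ω :=
  Submodule.le_topologicalClosure _ <| Submodule.subset_span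
    ⟨φ, hφ, hφ.memLp.coeFn_toLp, hφ.memLp_gradient.coeFn_toLp⟩

/-- A continuous linear identity on `H¹₀(Ω)` may be checked on test functions. -/
theorem inner_eq_of_mem_sobolevZero {G : L2Vec Ω} {h : L2 Ω}
    (H : ∀ φ (hφ : IsTest Ω φ), inner ℝ G (hφ.memLp_gradient.toLp (gradient φ)) =
      inner ℝ h (hφ.memLp.toLp φ)) {p : L2 Ω × L2Vec Ω} (hp : p ∈ sobolevZero Ω) :
    inner ℝ G p.2 = inner ℝ h p.1 := by
  let T : L2 Ω × L2Vec Ω →L[ℝ] ℝ :=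
    (innerSL ℝ G).comp (ContinuousLinearMap.snd ℝ _ _) -
      (innerSL ℝ h).comp (ContinuousLinearMap.fst ℝ _ _)
  have hle : sobolevZero Ω ≤ LinearMap.ker T.toLinearMap := by
    refine Submodule.topologicalClosure_minimal _ ?_ T.isClosed_ker
    rw [Submodule.span_le]
    rintro q ⟨φ, hφ, h1, h2⟩
    have e1 : q.1 = hφ.memLp.toLp φ := Lp.ext (h1.trans hφ.memLp.coeFn_toLp.symm)
    have e2 : q.2 = hφ.memLp_gradient.toLp (gradient φ) :=
      Lp.ext (h2.trans hφ.memLp_gradient.coeFn_toLp.symm)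
    change inner ℝ G q.2 - inner ℝ h q.1 = 0
    rw [e1, e2, H φ hφ, sub_self]
  exact sub_eq_zero.1 (hle hp)

section Weak

variable {C R : L2 Ω →L[ℝ] L2 Ω}

/-- Weak formulation of the wave operator, for `C` and `R` the multiplications by `c` and `1 / c`. -/
theorem mem_waveGraph_iff (hC : ∀ u, C u =ᵐ[volume.restrict Ω] fun x => c x * u x)
    (hR : ∀ u, R u =ᵐ[volume.restrict Ω] fun x => (c x)⁻¹ * u x) {u v : L2 Ω} :
    (u, v) ∈ waveGraph Ω c ↔ ∃ G : L2Vec Ω, (C u, G) ∈ sobolevZero Ω ∧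
      ∀ p ∈ sobolevZero Ω, inner ℝ G p.2 = inner ℝ (R v) p.1 := by
  have hRv (φ : Space d → ℝ) (hφ : IsTest Ω φ) :
      (fun x => inner ℝ (R v x) (hφ.memLp.toLp φ x)) =ᵐ[volume.restrict Ω]
        fun x => v x / c x * φ x := by
    filter_upwards [hR v, hφ.memLp.coeFn_toLp] with x h1 h2
    rw [h1, h2, real_inner_eq_re_inner, RCLike.inner_apply]
    simp
    ring
  have hGφ (G : L2Vec Ω) (φ : Space d → ℝ) (hφ : IsTest Ω φ) :
      inner ℝ G (hφ.memLp_gradient.toLp (gradient φ)) =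
        ∫ x in Ω, inner ℝ (G x) (gradient φ x) := by
    rw [L2.inner_def]
    refine integral_congr_ae ?_
    filter_upwards [hφ.memLp_gradient.coeFn_toLp] with x h1
    rw [h1]
  constructor
  · rintro ⟨w, G, hw, hcw, hG⟩
    have : w = C u := Lp.ext (by
      filter_upwards [hcw, hC u] with x h1 h2
      rw [h1, h2])
    subst this
    refine ⟨G, hw, fun p hp => inner_eq_of_mem_sobolevZero (fun φ hφ => ?_) hp⟩
    rw [hGφ G φ hφ, (hG φ hφ).2, L2.inner_def, integral_congr_ae (hRv φ hφ)]
  · rintro ⟨G, hG, H⟩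
    refine ⟨C u, G, hG, hC u, fun φ hφ => ⟨?_, ?_⟩⟩
    · exact (L2.integrable_inner (𝕜 := ℝ) (R v) (hφ.memLp.toLp φ)).congr (hRv φ hφ)
    · rw [← hGφ G φ hφ, H _ hφ.mem_sobolevZero, L2.inner_def, integral_congr_ae (hRv φ hφ)]

/-- The weights `c` and `1 / c` cancel pointwise. Testing the weak form of `𝒜 u = v` with `c u'`
therefore produces the unweighted product `⟪v, u'⟫`, which is why `-c Δ[c ·]` is symmetric in plain
`L²`. -/
theorem inner_mul_inv_mul (hC : ∀ u, C u =ᵐ[volume.restrict Ω] fun x => c x * u x)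
    (hR : ∀ u, R u =ᵐ[volume.restrict Ω] fun x => (c x)⁻¹ * u x)
    (h0 : ∀ᵐ x ∂(volume.restrict Ω), c x ≠ 0) (u v : L2 Ω) :
    inner ℝ (R v) (C u) = inner ℝ v u := by
  rw [L2.inner_def, L2.inner_def]
  refine integral_congr_ae ?_
  filter_upwards [hC u, hR v, h0] with x h1 h2 h3
  rw [h1, h2, real_inner_eq_re_inner, real_inner_eq_re_inner, RCLike.inner_apply,
    RCLike.inner_apply]
  simp
  field_simp

/-- The triples `(u, G, v)` with `v = 𝒜 u` and `G = ∇(c u)`. -/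
def energyGraph (C R : L2 Ω →L[ℝ] L2 Ω) : Submodule ℝ (L2 Ω × L2Vec Ω × L2 Ω) where
  carrier := {z | (C z.1, z.2.1) ∈ sobolevZero Ω ∧
    ∀ p ∈ sobolevZero Ω, inner ℝ z.2.1 p.2 = inner ℝ (R z.2.2) p.1}
  zero_mem' := ⟨by simp [← Prod.zero_eq_mk], fun p _ => by simp⟩
  add_mem' := fun {y z} hy hz => ⟨by simpa using Submodule.add_mem _ hy.1 hz.1, fun p hp => by
    simp [inner_add_left, hy.2 p hp, hz.2 p hp]⟩
  smul_mem' := fun a z hz => ⟨by simpa using Submodule.smul_mem _ a hz.1, fun p hp => by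
    simp [real_inner_smul_left, hz.2 p hp]⟩

theorem isClosed_energyGraph (C R : L2 Ω →L[ℝ] L2 Ω) :
    IsClosed (energyGraph C R : Set (L2 Ω × L2Vec Ω × L2 Ω)) := by
  have h1 : IsClosed {z : L2 Ω × L2Vec Ω × L2 Ω | (C z.1, z.2.1) ∈ sobolevZero Ω} :=
    (Submodule.isClosed_topologicalClosure _).preimage
      (f := fun z : L2 Ω × L2Vec Ω × L2 Ω => (C z.1, z.2.1)) (by fun_prop)
  have h2 : IsClosed {z : L2 Ω × L2Vec Ω × L2 Ω |
      ∀ p ∈ sobolevZero Ω, inner ℝ z.2.1 p.2 = inner ℝ (R z.2.2) p.1} := by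
    simp only [ofPred_forall]
    exact isClosed_biInter fun p _ => isClosed_eq (by fun_prop) (by fun_prop)
  exact h1.inter h2

end Weak

/-- The wave operator has a closed, symmetric, nonnegative, single-valued graph. -/
theorem waveGraph_properties (hΩ : IsOpen Ω) (hc : Measurable c) {cmin cmax : ℝ}
    (hcmin : 0 < cmin) (hcb : ∀ y ∈ Ω, cmin ≤ c y ∧ c y ≤ cmax) :
    IsClosed (waveGraph Ω c : Set (L2 Ω × L2 Ω)) ∧
    (∀ p ∈ waveGraph Ω c, ∀ q ∈ waveGraph Ω c, inner ℝ p.2 q.1 = inner ℝ p.1 q.2) ∧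
    (∀ p ∈ waveGraph Ω c, 0 ≤ inner ℝ p.2 p.1) ∧
    (∀ p ∈ waveGraph Ω c, p.1 = 0 → p.2 = 0) := by
  have hae : ∀ᵐ x ∂(volume.restrict Ω), cmin ≤ c x ∧ c x ≤ cmax :=
    (ae_restrict_iff' hΩ.measurableSet).2 (Eventually.of_forall hcb)
  have h0 : ∀ᵐ x ∂(volume.restrict Ω), c x ≠ 0 := by
    filter_upwards [hae] with x hx
    linarith [hx.1]
  obtain ⟨C, hC⟩ := exists_mulCLM (a := c) (K := cmax) hc.aestronglyMeasurable
    (by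
      filter_upwards [hae] with x hx
      rw [abs_of_pos (hcmin.trans_le hx.1)]
      exact hx.2)
  obtain ⟨R, hR⟩ := exists_mulCLM (a := fun x => (c x)⁻¹) (K := cmin⁻¹)
    (μ := volume.restrict Ω) hc.inv.aestronglyMeasurable
    (by
      filter_upwards [hae] with x hx
      rw [abs_of_pos (inv_pos.2 (hcmin.trans_le hx.1))]
      exact inv_anti₀ hcmin hx.1)
  have hiff {u v : L2 Ω} := mem_waveGraph_iff hC hR (u := u) (v := v)
  have hRC := inner_mul_inv_mul hC hR h0
  refine ⟨?_, ?_, ?_, ?_⟩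
  -- The graph is the image of the closed space of triples `(u, G, v)` under the map forgetting `G`.
  -- Its range is closed because `‖G‖² = ⟪v, u⟫` bounds the forgotten component by the others.
  · let T : energyGraph C R →ₗ[ℝ] L2 Ω × L2 Ω :=
      ((LinearMap.fst ℝ _ _).prod ((LinearMap.snd ℝ _ _).comp (LinearMap.snd ℝ _ _))).comp
        (energyGraph C R).subtype
    have hT : AntilipschitzWith 1 T := by
      refine AddMonoidHomClass.antilipschitz_of_bound T fun ⟨⟨u, G, v⟩, hz⟩ => ?_
      have e : inner ℝ G G = inner ℝ v u := by
        rw [← hRC u v]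
        exact hz.2 _ hz.1
      change max ‖u‖ (max ‖G‖ ‖v‖) ≤ 1 * max ‖u‖ ‖v‖
      have hu := le_max_left ‖u‖ ‖v‖
      have hv := le_max_right ‖u‖ ‖v‖
      have hG : ‖G‖ ≤ max ‖u‖ ‖v‖ := by
        refine abs_le_of_sq_le_sq' ?_ ((norm_nonneg _).trans hu) |>.2
        rw [← real_inner_self_eq_norm_sq, e]
        calc inner ℝ v u ≤ ‖v‖ * ‖u‖ := real_inner_le_norm v u
          _ ≤ _ := by
            rw [sq]
            exact mul_le_mul hv hu (norm_nonneg _) ((norm_nonneg _).trans hu)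
      rw [one_mul]
      exact max_le hu (max_le hG hv)
    have hcl : IsClosed (range T) := by
      have : CompleteSpace (energyGraph C R) := (isClosed_energyGraph C R).completeSpace_coe
      refine hT.isClosed_range ?_
      have : UniformContinuous (fun z : L2 Ω × L2Vec Ω × L2 Ω => (z.1, z.2.2)) :=
        uniformContinuous_fst.prodMk (uniformContinuous_snd.comp uniformContinuous_snd)
      exact this.comp uniformContinuous_subtype_val
    convert hcl using 1
    ext ⟨u, v⟩
    refine hiff.trans ⟨fun ⟨G, h⟩ => ⟨⟨(u, G, v), h⟩, rfl⟩, ?_⟩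
    rintro ⟨⟨⟨u', G, v'⟩, h⟩, e⟩
    obtain ⟨rfl, rfl⟩ := Prod.mk.inj e
    exact ⟨G, h⟩
  · rintro ⟨u, v⟩ hp ⟨u', v'⟩ hq
    obtain ⟨G, hG, h⟩ := hiff.1 hp
    obtain ⟨G', hG', h'⟩ := hiff.1 hq
    -- Each weak equation is tested with the other solution; both sides become the Dirichlet form
    -- `⟪G, G'⟫`.
    have e := h _ hG'
    have e' := h' _ hG
    rw [hRC] at e e'
    change inner ℝ v u' = inner ℝ u v'
    rw [← e, real_inner_comm v' u, ← e', real_inner_comm]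
  · rintro ⟨u, v⟩ hp
    obtain ⟨G, hG, h⟩ := hiff.1 hp
    have e := h _ hG
    rw [hRC] at e
    change 0 ≤ inner ℝ v u
    rw [← e]
    exact real_inner_self_nonneg
  · rintro ⟨u, v⟩ hp (rfl : u = 0)
    obtain ⟨G, hG, h⟩ := hiff.1 hp
    -- With `u = 0` the energy identity reads `‖G‖² = 0`, so `v / c` annihilates every test function
    -- and vanishes almost everywhere.
    have e := h _ hG
    rw [hRC, inner_zero_right, inner_self_eq_zero] at e
    change G = 0 at e
    have hloc : LocallyIntegrableOn (fun x => R v x) Ω volume :=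
      locallyIntegrableOn_of_locallyIntegrable_restrict
        ((Lp.memLp (R v)).locallyIntegrable (by norm_num))
    have hz := hΩ.ae_eq_zero_of_integral_contDiff_smul_eq_zero hloc fun φ h1 h2 h3 => by
      have hφ : IsTest Ω φ := ⟨h1, h2, h3⟩
      have e1 := h _ hφ.mem_sobolevZero
      rw [e, inner_zero_left, L2.inner_def] at e1
      rw [← setIntegral_eq_integral_of_forall_compl_eq_zero (s := Ω) fun x hx => by
        rw [image_eq_zero_of_notMem_tsupport fun h' => hx (h3 h'), zero_smul]]
      rw [e1]
      refine integral_congr_ae ?_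
      filter_upwards [hφ.memLp.coeFn_toLp] with x hx
      rw [hx]
      simp [RCLike.inner_apply]
    rw [← ae_restrict_iff' hΩ.measurableSet] at hz
    apply Lp.ext
    filter_upwards [hz, hR v, h0, Lp.coeFn_zero ℝ 2 (volume.restrict Ω)] with x h1 h2 h3 h4
    rw [h4]
    rw [h1] at h2
    exact (mul_eq_zero.1 h2.symm).resolve_left (inv_ne_zero h3)

end WaveOperator

/-! ### Series of mutually orthogonal vectors. -/

section OrthogonalSeries

variable {H ι : Type*} [NormedAddCommGroup H] [InnerProductSpace ℝ H] {E : ι → Submodule ℝ H}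

theorem summable_iff_norm_sq_of_mem [CompleteSpace H]
    (hE : OrthogonalFamily ℝ (fun i => E i) fun i => (E i).subtypeₗᵢ) {a : ι → H}
    (ha : ∀ i, a i ∈ E i) : Summable a ↔ Summable fun i => ‖a i‖ ^ 2 :=
  hE.summable_iff_norm_sq_summable fun i => ⟨a i, ha i⟩

/-- For orthogonal terms, convergence is square summability of the norms, which bounded multipliers
preserve. -/
theorem summable_smul_of_mem [CompleteSpace H]
    (hE : OrthogonalFamily ℝ (fun i => E i) fun i => (E i).subtypeₗᵢ) {a : ι → H}
    (ha : ∀ i, a i ∈ E i) (hs : Summable a) {φ : ι → ℝ} (hφ : ∀ i, |φ i| ≤ 1) :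
    Summable fun i => φ i • a i := by
  rw [summable_iff_norm_sq_of_mem hE fun i => (E i).smul_mem _ (ha i)]
  refine Summable.of_nonneg_of_le (fun i => sq_nonneg _) (fun i => ?_)
    ((summable_iff_norm_sq_of_mem hE ha).1 hs)
  rw [norm_smul]
  exact pow_le_pow_left₀ (by positivity)
    (mul_le_of_le_one_left (norm_nonneg _) (hφ i)) 2

theorem inner_eq_of_hasSum (hE : OrthogonalFamily ℝ (fun i => E i) fun i => (E i).subtypeₗᵢ)
    {a : ι → H} (ha : ∀ i, a i ∈ E i) {x : H} (hx : HasSum a x) {i : ι} {v : H} (hv : v ∈ E i) :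
    inner ℝ v x = inner ℝ v (a i) := by
  refine (hx.mapL (innerSL ℝ v)).unique (hasSum_single i fun j hj => ?_)
  exact hE hj.symm ⟨v, hv⟩ ⟨a j, ha j⟩

/-- Parseval's identity: cross terms vanish by orthogonality, leaving a single sum. -/
theorem hasSum_inner_of_mem (hE : OrthogonalFamily ℝ (fun i => E i) fun i => (E i).subtypeₗᵢ)
    {a b : ι → H} (ha : ∀ i, a i ∈ E i) (hb : ∀ i, b i ∈ E i) {x y : H} (hx : HasSum a x)
    (hy : HasSum b y) : HasSum (fun i => inner ℝ (a i) (b i)) (inner ℝ x y) := by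
  rw [real_inner_comm]
  refine (hx.mapL (innerSL ℝ y)).congr_fun fun i => ?_
  change _ = inner ℝ y (a i)
  rw [real_inner_comm (a i) y, inner_eq_of_hasSum hE hb hy (ha i)]

/-- This identifies the projections in `funCalc` with the terms of a given expansion. Completeness
of the family plays no role. -/
theorem starProjection_closure_eq_of_hasSum [CompleteSpace H]
    (hE : OrthogonalFamily ℝ (fun i => E i) fun i => (E i).subtypeₗᵢ) {a : ι → H}
    (ha : ∀ i, a i ∈ E i) {x : H} (hx : HasSum a x) (i : ι) :
    (E i).topologicalClosure.starProjection x = a i := by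
  refine Submodule.eq_starProjection_of_mem_orthogonal
    (Submodule.le_topologicalClosure _ (ha i)) ?_
  rw [Submodule.orthogonal_closure, Submodule.mem_orthogonal]
  intro v hv
  rw [inner_sub_right, inner_eq_of_hasSum hE ha hx hv, sub_self]

end OrthogonalSeries

/-! ### Eigenfunction expansion of the wave. -/

section Wave

variable {d : ℕ} {Ω : Set (Space d)} {c : Space d → ℝ} {f : ℝ → ℝ}

theorem mem_eigenSpace_iff {θ : ℝ} {v : L2 Ω} :
    v ∈ eigenSpace Ω c θ ↔ (v, θ • v) ∈ waveGraph Ω c :=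
  Iff.rfl

theorem orthogonalFamily_eigenSpace
    (hsymm : ∀ p ∈ waveGraph Ω c, ∀ q ∈ waveGraph Ω c, inner ℝ p.2 q.1 = inner ℝ p.1 q.2) :
    OrthogonalFamily ℝ (fun θ => eigenSpace Ω c θ) fun θ => (eigenSpace Ω c θ).subtypeₗᵢ := by
  rintro θ η hne ⟨u, hu⟩ ⟨v, hv⟩
  have h := hsymm _ (mem_eigenSpace_iff.1 hu) _ (mem_eigenSpace_iff.1 hv)
  rw [real_inner_smul_left, real_inner_smul_right] at h
  change inner ℝ u v = 0
  exact (mul_eq_mul_right_iff.1 h).resolve_left hne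

theorem eq_zero_of_mem_eigenSpace_of_neg
    (hpos : ∀ p ∈ waveGraph Ω c, 0 ≤ inner ℝ p.2 p.1) {θ : ℝ} (hθ : θ < 0) {v : L2 Ω}
    (hv : v ∈ eigenSpace Ω c θ) : v = 0 := by
  have h := hpos _ (mem_eigenSpace_iff.1 hv)
  rw [real_inner_smul_left] at h
  refine inner_self_eq_zero (𝕜 := ℝ).1 (le_antisymm ?_ real_inner_self_nonneg)
  exact nonpos_of_mul_nonneg_right h hθ

theorem initialTerm_mem_eigenSpace (x : Space d) (θ : ℝ) :
    initialTerm Ω c f x θ ∈ eigenSpace Ω c θ := by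
  refine Submodule.smul_mem _ _ ?_
  unfold deltaComponent
  split_ifs with h
  · exact h.choose_spec.1
  · exact Submodule.zero_mem _

theorem hasSum_initialState {x : Space d} (hsum : Summable (initialTerm Ω c f x)) :
    HasSum (initialTerm Ω c f x) (initialState Ω c f x) :=
  hsum.hasSum

/-- Bessel's inequality for `𝒜 u₀`. -/
theorem summable_smul_initialTerm
    (hsymm : ∀ p ∈ waveGraph Ω c, ∀ q ∈ waveGraph Ω c, inner ℝ p.2 q.1 = inner ℝ p.1 q.2)
    {x : Space d} (hsum : Summable (initialTerm Ω c f x)) {v : L2 Ω}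
    (hv : (initialState Ω c f x, v) ∈ waveGraph Ω c) :
    Summable fun θ => θ • initialTerm Ω c f x θ := by
  have hE := orthogonalFamily_eigenSpace hsymm
  have hI := initialTerm_mem_eigenSpace (Ω := Ω) (c := c) (f := f) x
  have hI' (θ : ℝ) : θ • initialTerm Ω c f x θ ∈ eigenSpace Ω c θ := Submodule.smul_mem _ _ (hI θ)
  rw [summable_iff_norm_sq_of_mem hE hI']
  refine summable_of_sum_le (c := ‖v‖ ^ 2) (fun θ => sq_nonneg _) fun F => ?_
  -- Symmetry moves `𝒜` from `u₀` to the eigenvector, and orthogonality keeps only the component of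
  -- `u₀` at `θ`.
  have h1 (θ : ℝ) : inner ℝ v (θ • initialTerm Ω c f x θ) = ‖θ • initialTerm Ω c f x θ‖ ^ 2 := by
    have e := hsymm _ hv _ (mem_eigenSpace_iff.1 (hI θ))
    have e2 := inner_eq_of_hasSum hE hI (hasSum_initialState hsum) (hI' θ)
    rw [real_inner_comm] at e2
    rw [real_inner_smul_right, e]
    refine (congrArg (θ * ·) e2).trans ?_
    simp only [real_inner_smul_left, ← real_inner_self_eq_norm_sq, real_inner_smul_right]
  have h2 := hE.norm_sum (fun θ => (⟨_, hI' θ⟩ : eigenSpace Ω c θ)) F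
  change ‖∑ θ ∈ F, θ • initialTerm Ω c f x θ‖ ^ 2 =
    ∑ θ ∈ F, ‖θ • initialTerm Ω c f x θ‖ ^ 2 at h2
  set s := ∑ θ ∈ F, θ • initialTerm Ω c f x θ
  have h3 : ‖s‖ ^ 2 = inner ℝ v s := by
    rw [h2, inner_sum]
    exact Finset.sum_congr rfl fun θ _ => (h1 θ).symm
  have h4 := real_inner_le_norm v s
  rw [← h2]
  nlinarith [sq_nonneg (‖v‖ - ‖s‖)]

/-- The eigenfunction expansions of the wave and of its image by the wave operator. -/
theorem wave_expansion
    (hclosed : IsClosed (waveGraph Ω c : Set (L2 Ω × L2 Ω)))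
    (hsymm : ∀ p ∈ waveGraph Ω c, ∀ q ∈ waveGraph Ω c, inner ℝ p.2 q.1 = inner ℝ p.1 q.2)
    {x : Space d} (hsum : Summable (initialTerm Ω c f x)) {v : L2 Ω}
    (hv : (initialState Ω c f x, v) ∈ waveGraph Ω c) (t : ℝ) :
    HasSum (fun θ => Real.cos (t * √θ) • initialTerm Ω c f x θ) (wave Ω c f x t) ∧
    ∃ w, (wave Ω c f x t, w) ∈ waveGraph Ω c ∧
      HasSum (fun θ => Real.cos (t * √θ) • θ • initialTerm Ω c f x θ) w := by
  have hE := orthogonalFamily_eigenSpace hsymm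
  have hI := initialTerm_mem_eigenSpace (Ω := Ω) (c := c) (f := f) x
  have hcos (θ : ℝ) : |Real.cos (t * √θ)| ≤ 1 := Real.abs_cos_le_one _
  have h1 : HasSum (fun θ => Real.cos (t * √θ) • initialTerm Ω c f x θ) (wave Ω c f x t) := by
    have e : wave Ω c f x t = ∑' θ, Real.cos (t * √θ) • initialTerm Ω c f x θ :=
      tsum_congr fun θ => by
        rw [starProjection_closure_eq_of_hasSum hE hI (hasSum_initialState hsum) θ]
    rw [e]
    exact (summable_smul_of_mem hE hI hsum hcos).hasSum
  have h2 := (summable_smul_of_mem hE (fun θ => Submodule.smul_mem _ θ (hI θ))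
    (summable_smul_initialTerm hsymm hsum hv) hcos).hasSum
  refine ⟨h1, _, ?_, h2⟩
  -- The finite partial sums, paired with their images, lie in the graph and converge in both
  -- components.
  refine hclosed.mem_of_tendsto (h1.prodMk h2) (Eventually.of_forall fun F => ?_)
  refine Submodule.sum_mem _ fun θ _ => ?_
  exact (waveGraph Ω c).smul_mem _ (mem_eigenSpace_iff.1 (hI θ))

theorem wave_zero
    (hsymm : ∀ p ∈ waveGraph Ω c, ∀ q ∈ waveGraph Ω c, inner ℝ p.2 q.1 = inner ℝ p.1 q.2)
    {x : Space d} (hsum : Summable (initialTerm Ω c f x)) :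
    wave Ω c f x 0 = initialState Ω c f x :=
  tsum_congr fun θ => by
    rw [starProjection_closure_eq_of_hasSum (orthogonalFamily_eigenSpace hsymm)
      (initialTerm_mem_eigenSpace x) (hasSum_initialState hsum) θ]
    simp

end Wave

/-! ### The scalar problem in time for one eigenvalue. -/

section TimeSignal

variable {f : ℝ → ℝ}

theorem integrable_mul_of_abs_le_one (hfi : Integrable f) {g : ℝ → ℝ} (hg : Measurable g)
    (h1 : ∀ t, |g t| ≤ 1) : Integrable fun t => f t * g t := by
  simpa only [mul_comm] using hfi.bdd_mul (c := 1) hg.aestronglyMeasurable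
    (Eventually.of_forall h1)

theorem integrable_mul_cos (hfi : Integrable f) (κ : ℝ) :
    Integrable fun t => f t * Real.cos (κ * t) :=
  integrable_mul_of_abs_le_one hfi (by fun_prop) fun _ => Real.abs_cos_le_one _

theorem integrable_mul_sin (hfi : Integrable f) (κ : ℝ) :
    Integrable fun t => f t * Real.sin (κ * t) :=
  integrable_mul_of_abs_le_one hfi (by fun_prop) fun _ => Real.abs_sin_le_one _

theorem norm_fourierHat_sq (hfi : Integrable f) (κ : ℝ) :
    ‖fourierHat f κ‖ ^ 2 =
      (∫ t, f t * Real.cos (κ * t)) ^ 2 + (∫ t, f t * Real.sin (κ * t)) ^ 2 := by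
  have e : fourierHat f κ = ((∫ t, f t * Real.cos (κ * t) : ℝ) : ℂ) +
      ((∫ t, f t * Real.sin (κ * t) : ℝ) : ℂ) * Complex.I := by
    rw [← integral_complex_ofReal, ← integral_complex_ofReal, ← integral_mul_const,
      ← integral_add (integrable_mul_cos hfi κ).ofReal
        ((integrable_mul_sin hfi κ).ofReal.mul_const _)]
    refine integral_congr_ae (Eventually.of_forall fun t => ?_)
    have : Complex.I * κ * t = ((κ * t : ℝ) : ℂ) * Complex.I := by push_cast; ring
    change (f t : ℂ) * Complex.exp (Complex.I * κ * t) = _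
    rw [this, Complex.exp_mul_I]
    push_cast
    ring
  rw [e, ← Complex.normSq_eq_norm_sq, Complex.normSq_add_mul_I]

theorem hasDerivAt_integral_Iic {g : ℝ → ℝ} (hg : Continuous g) (hgi : Integrable g) (t : ℝ) :
    HasDerivAt (fun y => ∫ s in Iic y, g s) (g t) t := by
  have e : (fun y => ∫ s in Iic y, g s) = fun y => (∫ s in Iic t, g s) + ∫ s in t..y, g s := by
    ext y
    rw [← intervalIntegral.integral_Iic_sub_Iic hgi.integrableOn hgi.integrableOn]
    ring
  rw [e]
  exact (intervalIntegral.integral_hasDerivAt_right hgi.intervalIntegrable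
    (hg.stronglyMeasurableAtFilter _ _) hg.continuousAt).const_add _

/-- The velocity `∫_{-∞}^t f(r) cos(κ(t - r)) dr` of the causal oscillation driven by `f`. -/
noncomputable def velocityMode (f : ℝ → ℝ) (κ t : ℝ) : ℝ :=
  ∫ r in Iic t, f r * Real.cos (κ * (t - r))

/-- The subtraction formula for the sine separates `t` from `r`, so that differentiation in `t` only
meets products of trigonometric functions with cumulative integrals. -/
theorem pressureMode_eq {θ : ℝ} (hfi : Integrable f) (t : ℝ) :
    pressureMode f θ t =
      (Real.sin (√θ * t) * (∫ r in Iic t, f r * Real.cos (√θ * r)) -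
        Real.cos (√θ * t) * ∫ r in Iic t, f r * Real.sin (√θ * r)) / √θ := by
  rw [pressureMode, convolution_def, ← integral_const_mul, ← integral_const_mul,
    ← integral_sub ((integrable_mul_cos hfi _).integrableOn.const_mul _)
      ((integrable_mul_sin hfi _).integrableOn.const_mul _), ← integral_div,
    ← integral_indicator measurableSet_Iic]
  refine integral_congr_ae (Eventually.of_forall fun r => ?_)
  simp only [ContinuousLinearMap.mul_apply', greenMode, indicator, mem_Iic, sub_nonneg]
  split_ifs
  · rw [mul_comm (t - r), mul_sub, Real.sin_sub]
    ring
  · simp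

theorem velocityMode_eq (hfi : Integrable f) (κ t : ℝ) :
    velocityMode f κ t = Real.cos (κ * t) * (∫ r in Iic t, f r * Real.cos (κ * r)) +
      Real.sin (κ * t) * ∫ r in Iic t, f r * Real.sin (κ * r) := by
  rw [velocityMode, ← integral_const_mul, ← integral_const_mul,
    ← integral_add ((integrable_mul_cos hfi _).integrableOn.const_mul _)
      ((integrable_mul_sin hfi _).integrableOn.const_mul _)]
  refine integral_congr_ae (Eventually.of_forall fun r => ?_)
  change f r * Real.cos (κ * (t - r)) = _
  rw [mul_sub, Real.cos_sub]
  ring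

theorem hasDerivAt_pressureMode (hf : Continuous f) (hfi : Integrable f) {θ : ℝ} (hθ : 0 < θ)
    (t : ℝ) : HasDerivAt (pressureMode f θ) (velocityMode f (√θ) t) t := by
  have hκ : √θ ≠ 0 := (Real.sqrt_pos.2 hθ).ne'
  have hA := hasDerivAt_integral_Iic (by fun_prop) (integrable_mul_cos hfi (√θ)) t
  have hB := hasDerivAt_integral_Iic (by fun_prop) (integrable_mul_sin hfi (√θ)) t
  have hl : HasDerivAt (fun y => √θ * y) (√θ) t := by
    simpa using (hasDerivAt_id t).const_mul (√θ)
  rw [funext (pressureMode_eq hfi), velocityMode_eq hfi]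
  -- The terms with `f t` from the moving endpoint cancel, since the Green's function vanishes at
  -- `0`.
  refine (((hl.sin.mul hA).sub (hl.cos.mul hB)).div_const (√θ)).congr_deriv ?_
  field_simp
  ring

theorem abs_setIntegral_mul_le (hfi : Integrable f) {g : ℝ → ℝ} (h1 : ∀ t, |g t| ≤ 1)
    (s : Set ℝ) : |∫ r in s, f r * g r| ≤ ∫ r, |f r| := by
  rw [← Real.norm_eq_abs]
  refine (norm_integral_le_of_norm_le (g := fun r => |f r|) hfi.abs.integrableOn
    (Eventually.of_forall fun r => ?_)).trans
    (setIntegral_le_integral hfi.abs (Eventually.of_forall fun r => abs_nonneg _))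
  rw [norm_mul]
  exact mul_le_of_le_one_right (norm_nonneg _) (h1 r)

theorem abs_velocityMode_le (hfi : Integrable f) (κ t : ℝ) :
    |velocityMode f κ t| ≤ ∫ r, |f r| :=
  abs_setIntegral_mul_le hfi (fun _ => Real.abs_cos_le_one _) _

/-- Boundedness suffices to make the products with `f` and `f'` integrable, as the integration by
parts on the whole line requires. -/
theorem abs_pressureMode_le (hfi : Integrable f) {θ : ℝ} (hθ : 0 < θ) (t : ℝ) :
    |pressureMode f θ t| ≤ 2 * (∫ r, |f r|) / √θ := by
  have hκ : 0 < √θ := Real.sqrt_pos.2 hθ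
  rw [pressureMode_eq hfi, abs_div, abs_of_pos hκ]
  refine div_le_div_of_nonneg_right ((abs_sub _ _).trans ?_) hκ.le
  rw [abs_mul, abs_mul, two_mul]
  exact add_le_add
    ((mul_le_of_le_one_left (abs_nonneg _) (Real.abs_sin_le_one _)).trans
      (abs_setIntegral_mul_le hfi (fun _ => Real.abs_cos_le_one _) _))
    ((mul_le_of_le_one_left (abs_nonneg _) (Real.abs_cos_le_one _)).trans
      (abs_setIntegral_mul_le hfi (fun _ => Real.abs_sin_le_one _) _))

theorem continuous_velocityMode (hf : Continuous f) (hfi : Integrable f) (κ : ℝ) :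
    Continuous (velocityMode f κ) := by
  have hA : Continuous fun y => ∫ r in Iic y, f r * Real.cos (κ * r) :=
    continuous_iff_continuousAt.2 fun t =>
      (hasDerivAt_integral_Iic (by fun_prop) (integrable_mul_cos hfi κ) t).continuousAt
  have hB : Continuous fun y => ∫ r in Iic y, f r * Real.sin (κ * r) :=
    continuous_iff_continuousAt.2 fun t =>
      (hasDerivAt_integral_Iic (by fun_prop) (integrable_mul_sin hfi κ) t).continuousAt
  rw [funext (velocityMode_eq hfi κ)]
  fun_prop

/-- Integration by parts moves the derivative in the filter to the pressure. -/
theorem filteredMode_eq (hf : ContDiff ℝ 1 f) (hfi : Integrable f) (hfi' : Integrable (deriv f))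
    {θ : ℝ} (hθ : 0 < θ) (t : ℝ) :
    filteredMode f θ t = ∫ s, f s * velocityMode f (√θ) (t + s) := by
  have hp (s : ℝ) : HasDerivAt (fun s => pressureMode f θ (t + s))
      (velocityMode f (√θ) (t + s)) s :=
    (hasDerivAt_pressureMode hf.continuous hfi hθ (t + s)).comp_const_add t s
  have hpc : Continuous fun s => pressureMode f θ (t + s) :=
    continuous_iff_continuousAt.2 fun s => (hp s).continuousAt
  have hvc : Continuous fun s => velocityMode f (√θ) (t + s) :=
    (continuous_velocityMode hf.continuous hfi _).comp (by fun_prop)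
  have i1 : Integrable (f * fun s => velocityMode f (√θ) (t + s)) := by
    rw [mul_comm]
    exact hfi.bdd_mul hvc.aestronglyMeasurable
      (Eventually.of_forall fun s => abs_velocityMode_le hfi _ _)
  have i2 : Integrable (f * fun s => pressureMode f θ (t + s)) := by
    rw [mul_comm]
    exact hfi.bdd_mul hpc.aestronglyMeasurable
      (Eventually.of_forall fun s => abs_pressureMode_le hfi hθ _)
  have i3 : Integrable (deriv f * fun s => pressureMode f θ (t + s)) := by
    rw [mul_comm]
    exact hfi'.bdd_mul hpc.aestronglyMeasurable
      (Eventually.of_forall fun s => abs_pressureMode_le hfi hθ _)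
  rw [integral_mul_deriv_eq_deriv_mul_of_integrable
    (fun s _ => (hf.differentiable one_ne_zero s).hasDerivAt) (fun s _ => hp s) i1 i3 i2,
    filteredMode, convolution_def, ← integral_neg, ← integral_neg_eq_self]
  refine integral_congr_ae (Eventually.of_forall fun s => ?_)
  simp

/-- The filtered mode at negative times, with the order of integration exchanged. -/
theorem integral_mul_velocityMode_neg (hfi : Integrable f) (κ t : ℝ) :
    ∫ s, f s * velocityMode f κ (-t + s) =
      ∫ s, f s * ∫ r in Ioi (t + s), f r * Real.cos (κ * (t + s - r)) := by
  -- The kernel is bounded by `1`, so Fubini applies with the integrable majorant `|f s| |f r|`.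
  -- Evenness of the cosine lets the same kernel serve both orders of integration.
  let k : ℝ × ℝ → ℝ := {z | t + z.2 ≤ z.1}.indicator fun z => Real.cos (κ * (t + z.2 - z.1))
  have hk : Measurable k := by
    refine Measurable.indicator (by fun_prop) (measurableSet_le (by fun_prop) (by fun_prop))
  have hk1 (z : ℝ × ℝ) : |k z| ≤ 1 := by
    by_cases h : t + z.2 ≤ z.1
    · simp only [k, indicator, mem_ofPred_eq, if_pos h]
      exact Real.abs_cos_le_one _
    · simp [k, h]
  have hi : Integrable (Function.uncurry fun s r => k (s, r) * (f s * f r)) :=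
    (hfi.mul_prod hfi).bdd_mul (c := 1) hk.aestronglyMeasurable (Eventually.of_forall hk1)
  have e1 (s : ℝ) : f s * velocityMode f κ (-t + s) = ∫ r, k (s, r) * (f s * f r) := by
    rw [velocityMode, ← integral_indicator measurableSet_Iic, ← integral_const_mul]
    refine integral_congr_ae (Eventually.of_forall fun r => ?_)
    simp only [k, indicator, mem_ofPred_eq, mem_Iic]
    have : r ≤ -t + s ↔ t + r ≤ s := by constructor <;> intro h <;> linarith
    rw [if_congr this rfl rfl]
    split_ifs
    · rw [← Real.cos_neg (κ * (-t + s - r))]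
      ring_nf
    · simp
  have e2 (r : ℝ) : ∫ s, k (s, r) * (f s * f r) =
      f r * ∫ s in Ioi (t + r), f s * Real.cos (κ * (t + r - s)) := by
    rw [← integral_Ici_eq_integral_Ioi, ← integral_indicator measurableSet_Ici,
      ← integral_const_mul]
    refine integral_congr_ae (Eventually.of_forall fun s => ?_)
    simp only [k, indicator, mem_ofPred_eq, mem_Ici]
    split_ifs
    · ring
    · simp
  simp_rw [e1]
  rw [integral_integral_swap hi]
  simp_rw [e2]

/-- The symmetrized filtered mode is `|f̂(√θ)|² cos(t√θ)`. -/
theorem filteredMode_add_neg (hf : ContDiff ℝ 1 f) (hfi : Integrable f)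
    (hfi' : Integrable (deriv f)) {θ : ℝ} (hθ : 0 < θ) (t : ℝ) :
    filteredMode f θ t + filteredMode f θ (-t) =
      ‖fourierHat f (√θ)‖ ^ 2 * Real.cos (t * √θ) := by
  rw [filteredMode_eq hf hfi hfi' hθ, filteredMode_eq hf hfi hfi' hθ,
    integral_mul_velocityMode_neg hfi, norm_fourierHat_sq hfi]
  generalize √θ = κ
  have hcs (y : ℝ) : Integrable fun r => f r * Real.cos (κ * (y - r)) :=
    integrable_mul_of_abs_le_one hfi (by fun_prop) fun _ => Real.abs_cos_le_one _
  set a := ∫ r, f r * Real.cos (κ * r)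
  set b := ∫ r, f r * Real.sin (κ * r)
  have hfull (y : ℝ) : ∫ r, f r * Real.cos (κ * (y - r)) =
      Real.cos (κ * y) * a + Real.sin (κ * y) * b := by
    rw [← integral_const_mul, ← integral_const_mul,
      ← integral_add ((integrable_mul_cos hfi _).const_mul _)
        ((integrable_mul_sin hfi _).const_mul _)]
    refine integral_congr_ae (Eventually.of_forall fun r => ?_)
    change f r * Real.cos (κ * (y - r)) = _
    rw [mul_sub, Real.cos_sub]
    ring
  -- The anticausal integral is the full integral minus the causal one. The causal parts at `t` and
  -- `-t` then cancel in the sum, leaving an integral over the whole line.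
  have hsplit (y : ℝ) : ∫ r in Ioi y, f r * Real.cos (κ * (y - r)) =
      Real.cos (κ * y) * a + Real.sin (κ * y) * b - velocityMode f κ y := by
    rw [← hfull, velocityMode, ← intervalIntegral.integral_Iic_add_Ioi (hcs y).integrableOn
      (hcs y).integrableOn (b := y)]
    ring
  have i1 : Integrable fun s => f s * velocityMode f κ (t + s) := by
    simpa only [mul_comm, Function.comp_apply] using hfi.bdd_mul
      ((continuous_velocityMode hf.continuous hfi κ).comp (by fun_prop :
        Continuous fun s => t + s)).aestronglyMeasurable
      (Eventually.of_forall fun s => abs_velocityMode_le hfi κ (t + s))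
  have i2 : Integrable fun s =>
      f s * (Real.cos (κ * (t + s)) * a + Real.sin (κ * (t + s)) * b) := by
    have h1 := integrable_mul_of_abs_le_one hfi (g := fun s => Real.cos (κ * (t + s)))
      (by fun_prop) fun _ => Real.abs_cos_le_one _
    have h2 := integrable_mul_of_abs_le_one hfi (g := fun s => Real.sin (κ * (t + s)))
      (by fun_prop) fun _ => Real.abs_sin_le_one _
    refine ((h1.mul_const a).add (h2.mul_const b)).congr (Eventually.of_forall fun s => ?_)
    simp only [Pi.add_apply]
    ring
  simp_rw [hsplit, mul_sub]
  rw [integral_sub i2 i1, add_sub_cancel]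
  change _ = (a ^ 2 + b ^ 2) * _
  have e : (fun s => f s * (Real.cos (κ * (t + s)) * a + Real.sin (κ * (t + s)) * b)) =
      fun s => (Real.cos (κ * t) * a + Real.sin (κ * t) * b) * (f s * Real.cos (κ * s)) +
        (Real.cos (κ * t) * b - Real.sin (κ * t) * a) * (f s * Real.sin (κ * s)) := by
    ext s
    rw [mul_add κ, Real.cos_add, Real.sin_add]
    ring
  rw [e, integral_add ((integrable_mul_cos hfi _).const_mul _)
    ((integrable_mul_sin hfi _).const_mul _), integral_const_mul, integral_const_mul, mul_comm t]
  change (_ : ℝ) * a + _ * b = _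
  ring

/-- Here `√θ = 0`, and division by zero makes `greenMode` vanish instead of taking its limit `t`. A
mode at `θ = 0` is thus absent from the data; the factor `θ` removes it from the stiffness matrix
too. -/
theorem filteredMode_of_nonpos {θ : ℝ} (hθ : θ ≤ 0) (t : ℝ) : filteredMode f θ t = 0 := by
  have h1 : greenMode θ = 0 := by
    ext s
    simp [greenMode, Real.sqrt_eq_zero_of_nonpos hθ]
  rw [filteredMode, pressureMode, h1]
  simp

end TimeSignal

/-! ### Termwise differentiation and the data matrix. -/

/-- An absolutely convergent cosine series with absolutely convergent second derivative. -/
theorem contDiff_two_cos_series {K : ℝ → ℝ} (hneg : ∀ θ < 0, K θ = 0) (h0 : Summable K)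
    (h2 : Summable fun θ => θ * K θ) :
    ContDiff ℝ 2 (fun t => ∑' θ, Real.cos (t * √θ) * K θ) ∧
      ∀ t, iteratedDeriv 2 (fun t => ∑' θ, Real.cos (t * √θ) * K θ) t =
        -∑' θ, Real.cos (t * √θ) * (θ * K θ) := by
  have hl (θ t : ℝ) : HasDerivAt (fun y => y * √θ) (√θ) t := by
    simpa using (hasDerivAt_id t).mul_const (√θ)
  -- For `θ < 0` the real square root is `0`, so this relies on `K` vanishing there.
  have hsq (θ : ℝ) : √θ * √θ * K θ = θ * K θ := by
    rcases lt_or_ge θ 0 with h | h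
    · simp [hneg θ h]
    · rw [Real.mul_self_sqrt h]
  have hu : Summable fun θ => |K θ| + |θ * K θ| := h0.abs.add h2.abs
  -- The first derivative is controlled by the two given series through `√θ ≤ 1 + θ`, a consequence
  -- of `(√θ - 1)² ≥ 0`.
  have hsqrt (θ : ℝ) : |√θ * K θ| ≤ |K θ| + |θ * K θ| := by
    rw [← hsq, abs_mul, abs_mul (√θ * √θ), abs_mul_self, abs_of_nonneg (Real.sqrt_nonneg θ)]
    nlinarith [abs_nonneg (K θ), mul_nonneg (sq_nonneg (√θ - 1)) (abs_nonneg (K θ)),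
      mul_nonneg (mul_self_nonneg (√θ)) (abs_nonneg (K θ))]
  have hs1 : Summable fun θ => √θ * K θ :=
    (hu.of_nonneg_of_le (fun _ => abs_nonneg _) hsqrt).of_abs
  have d1 (t : ℝ) : HasDerivAt (fun t => ∑' θ, Real.cos (t * √θ) * K θ)
      (∑' θ, -Real.sin (t * √θ) * (√θ * K θ)) t := by
    refine hasDerivAt_tsum (u := fun θ => |√θ * K θ|)
      (g := fun θ t => Real.cos (t * √θ) * K θ)
      (g' := fun θ t => -Real.sin (t * √θ) * (√θ * K θ)) (y₀ := 0) hs1.abs (fun θ y => ?_)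
      (fun θ y => ?_) (by simpa using h0) t
    · exact ((hl θ y).cos.mul_const (K θ)).congr_deriv (by ring)
    · rw [norm_mul, norm_neg]
      exact mul_le_of_le_one_left (norm_nonneg _) (Real.abs_sin_le_one _)
  have d2 (t : ℝ) : HasDerivAt (fun t => ∑' θ, -Real.sin (t * √θ) * (√θ * K θ))
      (∑' θ, -Real.cos (t * √θ) * (θ * K θ)) t := by
    refine hasDerivAt_tsum (u := fun θ => |θ * K θ|)
      (g := fun θ t => -Real.sin (t * √θ) * (√θ * K θ))
      (g' := fun θ t => -Real.cos (t * √θ) * (θ * K θ)) (y₀ := 0) h2.abs (fun θ y => ?_)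
      (fun θ y => ?_) (by simp) t
    · refine ((hl θ y).sin.neg.mul_const (√θ * K θ)).congr_deriv ?_
      rw [← hsq]
      ring
    · rw [norm_mul, norm_neg]
      exact mul_le_of_le_one_left (norm_nonneg _) (Real.abs_cos_le_one _)
  have hcont : Continuous fun t => ∑' θ, -Real.cos (t * √θ) * (θ * K θ) := by
    refine continuous_tsum (u := fun θ => |θ * K θ|) (fun θ => by fun_prop) h2.abs fun θ y => ?_
    rw [norm_mul, norm_neg]
    exact mul_le_of_le_one_left (norm_nonneg _) (Real.abs_cos_le_one _)
  have e1 := funext fun t => (d1 t).deriv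
  have e2 := funext fun t => (d2 t).deriv
  constructor
  · rw [show (2 : WithTop ℕ∞) = 1 + 1 by norm_num, contDiff_succ_iff_deriv]
    refine ⟨fun t => (d1 t).differentiableAt, by simp, ?_⟩
    rw [e1, contDiff_one_iff_deriv, e2]
    exact ⟨fun t => (d2 t).differentiableAt, hcont⟩
  · intro t
    rw [iteratedDeriv_succ, iteratedDeriv_one, e1, (d2 t).deriv, ← tsum_neg]
    simp_rw [neg_mul]

section Data

variable {d : ℕ} {Ω : Set (Space d)} {c : Space d → ℝ} {f : ℝ → ℝ}

open Classical in
/-- The weight of `cos(t√θ)` in the data; the mode `θ = 0` does not contribute. -/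
noncomputable def dataWeight (Ω : Set (Space d)) (c : Space d → ℝ) (f : ℝ → ℝ) (y z : Space d)
    (θ : ℝ) : ℝ :=
  if 0 < θ then inner ℝ (initialTerm Ω c f y θ) (initialTerm Ω c f z θ) else 0

theorem dataMatrix_eq (hf : ContDiff ℝ 1 f) (hfi : Integrable f) (hfi' : Integrable (deriv f))
    {m : ℕ} (x : Fin m → Space d) (t : ℝ) (r s : Fin m) :
    dataMatrix Ω c f x t r s = ∑' θ, Real.cos (t * √θ) * dataWeight Ω c f (x r) (x s) θ := by
  refine tsum_congr fun θ => ?_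
  unfold dataWeight
  split_ifs with hθ
  · rw [filteredMode_add_neg hf hfi hfi' hθ, initialTerm, initialTerm, real_inner_smul_left,
      real_inner_smul_right]
    ring
  · rw [filteredMode_of_nonpos (not_lt.1 hθ), filteredMode_of_nonpos (not_lt.1 hθ)]
    simp

/-- After multiplication by `θ` the cutoff in the weight disappears: negative eigenspaces are
trivial, and at `θ = 0` both sides vanish. -/
theorem mul_dataWeight (hpos : ∀ p ∈ waveGraph Ω c, 0 ≤ inner ℝ p.2 p.1) (y z : Space d) (θ : ℝ) :
    θ * dataWeight Ω c f y z θ = inner ℝ (initialTerm Ω c f y θ) (θ • initialTerm Ω c f z θ) := by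
  rw [real_inner_smul_right, dataWeight]
  split_ifs with h
  · rfl
  · rcases (not_lt.1 h).lt_or_eq with h | rfl
    · rw [eq_zero_of_mem_eigenSpace_of_neg hpos h (initialTerm_mem_eigenSpace y θ), inner_zero_left]
    · simp

/-- The data are twice continuously differentiable, with the second derivative taken termwise. -/
theorem contDiff_dataMatrix
    (hsymm : ∀ p ∈ waveGraph Ω c, ∀ q ∈ waveGraph Ω c, inner ℝ p.2 q.1 = inner ℝ p.1 q.2)
    (hpos : ∀ p ∈ waveGraph Ω c, 0 ≤ inner ℝ p.2 p.1)
    (hf : ContDiff ℝ 1 f) (hfi : Integrable f) (hfi' : Integrable (deriv f))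
    {m : ℕ} {x : Fin m → Space d} (hsum : ∀ s, Summable (initialTerm Ω c f (x s)))
    (hsum2 : ∀ s, Summable fun θ => θ • initialTerm Ω c f (x s) θ) (r s : Fin m) :
    ContDiff ℝ 2 (fun t => dataMatrix Ω c f x t r s) ∧
      (Summable fun θ => inner ℝ (initialTerm Ω c f (x r) θ) (θ • initialTerm Ω c f (x s) θ)) ∧
      ∀ t, iteratedDeriv 2 (fun t => dataMatrix Ω c f x t r s) t = -∑' θ, Real.cos (t * √θ) *
        inner ℝ (initialTerm Ω c f (x r) θ) (θ • initialTerm Ω c f (x s) θ) := by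
  have hE := orthogonalFamily_eigenSpace hsymm
  have hI (s : Fin m) := initialTerm_mem_eigenSpace (Ω := Ω) (c := c) (f := f) (x s)
  have h2 := (hasSum_inner_of_mem hE (hI r) (fun θ => Submodule.smul_mem _ θ (hI s θ))
    (hsum r).hasSum (hsum2 s).hasSum).summable
  have h0 : Summable (dataWeight Ω c f (x r) (x s)) := by
    refine Summable.of_norm_bounded
      (hasSum_inner_of_mem hE (hI r) (hI s) (hsum r).hasSum (hsum s).hasSum).summable.abs
      fun θ => ?_
    unfold dataWeight
    split_ifs
    · exact le_rfl
    · simp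
  have h := contDiff_two_cos_series (K := dataWeight Ω c f (x r) (x s))
    (fun θ hθ => if_neg hθ.not_gt) h0 (by simpa only [mul_dataWeight hpos] using h2)
  simp only [mul_dataWeight hpos] at h
  simp only [dataMatrix_eq hf hfi hfi']
  exact ⟨h.1, h2, h.2⟩

end Data

/-! ### Initial conditions of the Galerkin coefficients. -/

/-- The Galerkin coefficients of a linearly independent family start from a unit block. -/
theorem IsGalerkin.initial_coefficients {d n m : ℕ} {Ω : Set (Space d)} {A : L2 Ω →ₗ.[ℝ] L2 Ω}
    {U : Fin n × Fin m → L2 Ω} {hU : ∀ k, U k ∈ A.domain} {u₀ : Fin m → L2 Ω}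
    {g g' g'' : ℝ → Matrix (Fin n × Fin m) (Fin m) ℝ} (hg : IsGalerkin A U hU u₀ g g' g'')
    (hind : LinearIndependent ℝ U) {j : Fin n} (hj : ∀ s, U (j, s) = u₀ s) :
    g 0 = unitBlock j ∧ g' 0 = 0 := by
  have hinj := Fintype.linearIndependent_iff.1 hind
  constructor
  · ext k s
    have h : ∑ l, (g 0 l s - (unitBlock j : Matrix (Fin n × Fin m) (Fin m) ℝ) l s) • U l = 0 := by
      simp only [sub_smul, Finset.sum_sub_distrib]
      have e := hg.initial_state s
      unfold galerkinField at e
      rw [e, sub_eq_zero]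
      simp [unitBlock, Matrix.one_apply, hj]
    exact sub_eq_zero.1 (hinj _ h k)
  · ext k s
    have h : HasDerivWithinAt (fun t => galerkinField U (g t) s) (∑ l, g' 0 l s • U l) (Ici 0) 0 :=
      HasDerivWithinAt.fun_sum fun l _ => (hg.hasDeriv 0 le_rfl l s).smul_const (U l)
    -- One-sided derivatives on `[0, ∞)` are unique, so the combination of the snapshots with
    -- coefficients `g' 0` is zero.
    exact hinj _ ((uniqueDiffWithinAt_Ici (0 : ℝ)).eq_deriv _ h (hg.initial_velocity s)) k

end WaveROM

/-! ### Stiffness matrix and data compared mode by mode. -/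

theorem theorem2 {d : ℕ} (hd : d = 2 ∨ d = 3)
    (Ω : Set (WaveROM.Space d)) (hΩ : IsOpen Ω) (hΩb : Bornology.IsBounded Ω)
    (c : WaveROM.Space d → ℝ) (hc : Measurable c)
    (cmin cmax : ℝ) (hcmin : 0 < cmin) (hcb : ∀ y ∈ Ω, cmin ≤ c y ∧ c y ≤ cmax)
    (f : ℝ → ℝ) (hf : ContDiff ℝ 1 f) (hfi : Integrable f) (hfi' : Integrable (deriv f))
    (n m : ℕ) (hn : 0 < n) (x : Fin m → WaveROM.Space d) (hx : ∀ s, x s ∈ Ω)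
    (cbar : ℝ) (hcbar : ∀ s, ∀ᶠ y in 𝓝 (x s), c y = cbar)
    (hsum : ∀ s, Summable (WaveROM.initialTerm Ω c f (x s)))
    (hdom : ∀ s, WaveROM.initialState Ω c f (x s) ∈ (WaveROM.waveOp Ω c).domain)
    (τ : ℝ) (hτ : 0 < τ)
    (U : Fin n × Fin m → WaveROM.L2 Ω) (hUdef : U = WaveROM.snapshot Ω c f x τ)
    (hind : LinearIndependent ℝ U) :
    ∃ hU : ∀ k, U k ∈ (WaveROM.waveOp Ω c).domain,
      (∀ g g' g'' : ℝ → Matrix (Fin n × Fin m) (Fin m) ℝ,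
        WaveROM.IsGalerkin (WaveROM.waveOp Ω c) U hU
          (fun s => WaveROM.initialState Ω c f (x s)) g g' g'' →
        g 0 = WaveROM.unitBlock ⟨0, hn⟩ ∧ g' 0 = 0) ∧
      (∀ r s, ContDiff ℝ 2 fun t => WaveROM.dataMatrix Ω c f x t r s) ∧
      ∀ i j : Fin n,
        WaveROM.block (WaveROM.stiffness (WaveROM.waveOp Ω c) U hU) i j =
          Matrix.of (fun r s => ∫ y in Ω, U (i, r) y * WaveROM.waveOp Ω c ⟨U (j, s), hU (j, s)⟩ y) ∧
        WaveROM.block (WaveROM.stiffness (WaveROM.waveOp Ω c) U hU) i j =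
          -((1 / 2 : ℝ) • (WaveROM.dataAccel Ω c f x τ ((i : ℕ) + (j : ℕ)) +
            WaveROM.dataAccel Ω c f x τ (((i : ℕ) : ℤ) - ((j : ℕ) : ℤ)).natAbs)) := by
  obtain ⟨hclosed, hsymm, hpos, hsv⟩ := WaveROM.waveGraph_properties hΩ hc hcmin hcb
  have hgraph := Submodule.toLinearPMap_graph_eq _ hsv
  subst hUdef
  have hv (s : Fin m) : ∃ v, (WaveROM.initialState Ω c f (x s), v) ∈ WaveROM.waveGraph Ω c := by
    obtain ⟨⟨_, v⟩, hp, rfl⟩ := hdom s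
    exact ⟨v, hp⟩
  choose v hv using hv
  have hexp (s : Fin m) (t : ℝ) := WaveROM.wave_expansion hclosed hsymm (hsum s) (hv s) t
  have hU (k : Fin n × Fin m) :
      WaveROM.snapshot Ω c f x τ k ∈ (WaveROM.waveOp Ω c).domain := by
    obtain ⟨-, w, hw, -⟩ := hexp k.2 ((k.1 : ℕ) * τ)
    exact ⟨_, hw, rfl⟩
  have hA (k : Fin n × Fin m) : HasSum
      (fun θ => Real.cos ((k.1 : ℕ) * τ * √θ) • θ • WaveROM.initialTerm Ω c f (x k.2) θ)
      (WaveROM.waveOp Ω c ⟨WaveROM.snapshot Ω c f x τ k, hU k⟩) := by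
    obtain ⟨-, w, hw, hws⟩ := hexp k.2 ((k.1 : ℕ) * τ)
    have hm : (WaveROM.snapshot Ω c f x τ k,
        WaveROM.waveOp Ω c ⟨WaveROM.snapshot Ω c f x τ k, hU k⟩) ∈ WaveROM.waveGraph Ω c :=
      Submodule.mem_graph_toLinearPMap hsv ⟨_, hU k⟩
    -- Both `𝒜 U_k` and the termwise series are values over the same point of a single-valued graph,
    -- hence equal.
    have e := hsv _ ((WaveROM.waveGraph Ω c).sub_mem hm hw) (sub_self _)
    rwa [show WaveROM.waveOp Ω c ⟨WaveROM.snapshot Ω c f x τ k, hU k⟩ = w from sub_eq_zero.1 e]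
  have hD (r s : Fin m) := WaveROM.contDiff_dataMatrix hsymm hpos hf hfi hfi' hsum
    (fun s => WaveROM.summable_smul_initialTerm hsymm (hsum s) (hv s)) r s
  refine ⟨hU, fun g g' g'' hg => hg.initial_coefficients hind fun s => ?_, fun r s => (hD r s).1,
    fun i j => ⟨rfl, ?_⟩⟩
  · simpa [WaveROM.snapshot] using WaveROM.wave_zero hsymm (hsum s)
  · ext r s
    obtain ⟨-, hJ, hD2⟩ := hD r s
    have hI (s : Fin m) := WaveROM.initialTerm_mem_eigenSpace (Ω := Ω) (c := c) (f := f) (x s)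
    have hS := WaveROM.hasSum_inner_of_mem (WaveROM.orthogonalFamily_eigenSpace hsymm)
      (fun θ => Submodule.smul_mem _ _ (hI r θ))
      (fun θ => Submodule.smul_mem _ _ (Submodule.smul_mem _ _ (hI s θ)))
      (hexp r ((i : ℕ) * τ)).1 (hA (j, s))
    have hcos (t : ℝ) : Summable fun θ => Real.cos (t * √θ) *
        inner ℝ (WaveROM.initialTerm Ω c f (x r) θ) (θ • WaveROM.initialTerm Ω c f (x s) θ) :=
      Summable.of_norm_bounded hJ.abs fun θ => by
        rw [norm_mul]
        exact mul_le_of_le_one_left (norm_nonneg _) (Real.abs_cos_le_one _)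
    have hL : WaveROM.block (WaveROM.stiffness (WaveROM.waveOp Ω c)
        (WaveROM.snapshot Ω c f x τ) hU) i j r s =
        inner ℝ (WaveROM.wave Ω c f (x r) ((i : ℕ) * τ))
          (WaveROM.waveOp Ω c ⟨WaveROM.snapshot Ω c f x τ (j, s), hU (j, s)⟩) := by
      rw [MeasureTheory.L2.inner_def]
      refine integral_congr_ae (Eventually.of_forall fun y => ?_)
      simp [WaveROM.snapshot, mul_comm]
    -- The absolute value of the index difference is harmless because the cosine is even and `τ√θ ≥
    -- 0`.
    have habs (θ : ℝ) : Real.cos ((((i : ℕ) : ℤ) - ((j : ℕ) : ℤ)).natAbs * τ * √θ) =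
        Real.cos ((i : ℕ) * τ * √θ - (j : ℕ) * τ * √θ) := by
      rw [← Real.cos_abs (_ - _), Nat.cast_natAbs, ← sub_mul, ← sub_mul, mul_assoc, mul_assoc,
        abs_mul, abs_of_nonneg (mul_nonneg hτ.le (Real.sqrt_nonneg θ))]
      push_cast
      rfl
    rw [hL, ← hS.tsum_eq]
    simp only [Matrix.neg_apply, Matrix.smul_apply, Matrix.add_apply, WaveROM.dataAccel,
      Matrix.of_apply, hD2, smul_eq_mul]
    rw [← neg_add, ← (hcos _).tsum_add (hcos _), mul_neg, neg_neg, ← tsum_mul_left]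
    refine tsum_congr fun θ => ?_
    -- What remains for each `θ` is `cos α cos β = (cos (α + β) + cos (α - β)) / 2`, with `α = iτ√θ`
    -- and `β = jτ√θ`.
    rw [habs, real_inner_smul_left, real_inner_smul_right, Nat.cast_add, add_mul, add_mul,
      Real.cos_add, Real.cos_sub]
    ring
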